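/- Let $k\ge 1$, let $Z\sim N(\mu,I_k)$ with $\mu\in\mathbb{R}^k$ unknown, and write $P_\mu$, $E_\mu$ for probability and expectation under $\mu$. Fix $\alpha\in(0,1)$ and $\theta_0\in\mathbb{R}$. Let $\overline\theta(\mu)=\min_{1\le j\le k}\mu(j)$. A test $\phi$ is a measurable function of $Z$ with values in $[0,1]$; it has level $\alpha$ for $H_{0,\theta_0}:\overline\theta(\mu)\ge\theta_0$ if $E_\mu\phi\le\alpha$ for all $\mu$ with $\overline\theta(\mu)\ge\theta_0$. For $b\geq 0$, its minimax power against $M_1^*(\theta_0,b)=\{\mu : \overline\theta(\mu)\le\theta_0-b\}$ is $\inf_{\mu\in M_1^*(\theta_0,b)}E_\mu\phi$. For a statistic $S$, let $q_{\mu,\tau}(S)=\inf\{x : P_\mu(S\le x)\ge\tau\}$ be its $\tau$-quantile under $\mu$. (i) For every $k\ge 1$ and $b>0$, the minimax power against $M_1^*(\theta_0,b)$ of any level-$\alpha$ test of $H_{0,\theta_0}$ is at most $$\overline\beta(b;k)=P_{(-b,0,\ldots,0)}\Big(\sum_{j=1}^k e^{-Z_jb}>\tilde c_\alpha\Big),\qquad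 \tilde c_\alpha=q_{(0,\ldots,0),1-\alpha}\Big(\sum_{j=1}^k e^{-Z_jb}\Big).$$ Moreover, the test that rejects when $\sum_{j=1}^k e^{-Z_jb}>\tilde c_\alpha$ is the Neyman–Pearson test of $\mu=0$ against the uniform mixture of the points $-be_1,\ldots,-be_k$: it has size exactly $\alpha$ at $\mu=0$, it is most powerful against the mixture $\frac1k\sum_{j=1}^kP_{-be_j}$ among all tests $\psi$ with $E_0\psi\le\alpha$, and its power against that mixture is $\overline\beta(b;k)$. (ii) For every $0<\varepsilon<2$, $\overline\beta\big(\sqrt{(2-\varepsilon)\log k};k\big)\to\alpha$ as $k\to\infty$. (iii) Let $S_\infty(Z,\theta)=\max_{1\le j\le k}\max\{\theta-Z_j,0\}$ and let $c_{\infty,\alpha}=\sup\{q_{\mu,1-\alpha}(S_\infty(Z,\theta)) : \mu\in\mathbb{R}^k,\ \theta\in\mathbb{R},\ \theta\le\min_j\mu(j)\}$. Let $\beta_{\theta_0,\infty}(b;k)$ be the minimax power against $M_1^*(\theta_0,b)$ of the $L^\infty$ test, which rejects when $S_\infty(Z,\theta_0)>c_{\infty,\alpha}$. Then for every $\varepsilon>0$,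 $\beta_{\theta_0,\infty}\big(\sqrt{(2+\varepsilon)\log k};k\big)\to1$ as $k\to\infty$. -/

import Mathlib

open MeasureTheory ProbabilityTheory Filter Topology

namespace MomentIneq

noncomputable section

/-- The law `N(μ, I_k)` of the data `Z`: independent coordinates `Z_j ~ N(μ j, 1)`. -/
def law {k : ℕ} (μ : Fin k → ℝ) : Measure (Fin k → ℝ) :=
  Measure.pi fun j => gaussianReal (μ j) 1

/-- The identified set `Θ₀(μ) = (-∞, min_j μ j]` (used for `k ≥ 1`). -/
def identifiedSet {k : ℕ} (μ : Fin k → ℝ) : Set ℝ := Set.Iic (⨅ j, μ j)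

/-- The null region `M₀(θ₀)` of `H₀ : θ₀ ∈ Θ₀(μ)`. -/
def nullSet (k : ℕ) (θ₀ : ℝ) : Set (Fin k → ℝ) := {μ | θ₀ ∈ identifiedSet μ}

/-- The alternative `M₁*(θ₀, b)`: the means for which every point of the identified set is
at most `θ₀ - b`. -/
def altSet (k : ℕ) (θ₀ b : ℝ) : Set (Fin k → ℝ) :=
  {μ | ∀ θ ∈ identifiedSet μ, θ ≤ θ₀ - b}

/-- A (possibly randomized) test: a measurable function of the data with values in `[0, 1]`;
`φ z` is the probability of rejecting when `z` is observed. -/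
structure IsTest {k : ℕ} (φ : (Fin k → ℝ) → ℝ) : Prop where
  measurable : Measurable φ
  mem_Icc : ∀ z, φ z ∈ Set.Icc (0 : ℝ) 1

/-- Level `α` tests of `H₀ : θ₀ ∈ Θ₀(μ)`, that is, `sup_{μ ∈ M₀(θ₀)} E_μ φ ≤ α`. -/
structure IsLevelTest {k : ℕ} (α θ₀ : ℝ) (φ : (Fin k → ℝ) → ℝ) : Prop extends IsTest φ where
  size_le : ∀ μ ∈ nullSet k θ₀, ∫ z, φ z ∂(law μ) ≤ α

/-- The minimax power `inf_{μ ∈ M₁*(θ₀, b)} E_μ φ`. -/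
def minimaxPower {k : ℕ} (θ₀ b : ℝ) (φ : (Fin k → ℝ) → ℝ) : ℝ :=
  ⨅ μ : altSet k θ₀ b, ∫ z, φ z ∂(law μ.1)

/-- The `τ`-quantile of the statistic `S` when the data have law `P`. -/
def quantile {Ω : Type*} [MeasurableSpace Ω] (P : Measure Ω) (S : Ω → ℝ) (τ : ℝ) : ℝ :=
  sInf {x : ℝ | τ ≤ P.real {z | S z ≤ x}}

/-- The nonrandomized test that rejects when `S > c`. -/
def thresholdTest {k : ℕ} (S : (Fin k → ℝ) → ℝ) (c : ℝ) : (Fin k → ℝ) → ℝ :=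
  Set.indicator {z | c < S z} 1

/-- The statistic `∑_j exp(-Z_j b)`. -/
def expStat (k : ℕ) (b : ℝ) (z : Fin k → ℝ) : ℝ := ∑ j, Real.exp (-(z j) * b)

/-- The critical value `c̃_α`: the `1 - α` quantile of `∑_j exp(-Z_j b)` under `μ = 0`. -/
def expCrit (k : ℕ) (α b : ℝ) : ℝ :=
  quantile (law (0 : Fin k → ℝ)) (expStat k b) (1 - α)

/-- The mean vector `(-b, 0, …, 0)`. -/
def firstSpike (k : ℕ) (b : ℝ) : Fin k → ℝ := fun j => if j.val = 0 then -b else 0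

/-- The bound `β̄(b; k) = P_{(-b,0,…,0)} (∑_j exp(-Z_j b) > c̃_α)`. -/
def betaBar (k : ℕ) (α b : ℝ) : ℝ :=
  (law (firstSpike k b)).real {z | expCrit k α b < expStat k b z}

/-- The law of the data when the mean is drawn uniformly from the points `-b e_j`. -/
def spikeMixture (k : ℕ) (b : ℝ) : Measure (Fin k → ℝ) :=
  (k : ENNReal)⁻¹ • ∑ j : Fin k, law (Pi.single j (-b))

/-- `φ` is a most powerful (Neyman-Pearson) test of size `α` of the simple hypothesis `P`
against the simple alternative `Q`. -/
structure IsMostPowerful {k : ℕ} (P Q : Measure (Fin k → ℝ)) (α : ℝ)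
    (φ : (Fin k → ℝ) → ℝ) : Prop extends IsTest φ where
  size_eq : ∫ z, φ z ∂P = α
  le_power : ∀ ψ : (Fin k → ℝ) → ℝ, IsTest ψ → ∫ z, ψ z ∂P ≤ α →
    ∫ z, ψ z ∂Q ≤ ∫ z, φ z ∂Q

/-- The statistic `S_∞(Z, θ₀) = max_j (θ₀ - Z_j)_+` (used for `k ≥ 1`). -/
def supStat (k : ℕ) (θ₀ : ℝ) (z : Fin k → ℝ) : ℝ := ⨆ j, max (θ₀ - z j) 0

/-- The least favorable critical value `c_{∞,α}`: the supremum of the `1 - α` quantiles of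
`S_∞(Z, θ)` under `μ`, over all `μ` and `θ` with `θ ≤ min_j μ j`. -/
def supCrit (k : ℕ) (α : ℝ) : ℝ :=
  sSup {c : ℝ | ∃ (μ : Fin k → ℝ) (θ : ℝ), θ ∈ identifiedSet μ ∧
    c = quantile (law μ) (supStat k θ) (1 - α)}

/-- The `L^∞` test, which rejects when `S_∞(Z, θ₀) > c_{∞,α}`. -/
def supTest (k : ℕ) (α θ₀ : ℝ) : (Fin k → ℝ) → ℝ :=
  thresholdTest (supStat k θ₀) (supCrit k α)

end

end MomentIneq

/-!
The likelihood ratio of the uniform mixture of the spikes `-b e_j` with respect to `N(0, I)` is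
`k⁻¹ ∑ j, exp (-z_j b - b ^ 2 / 2)` (`likelihoodRatio`), an increasing function of `expStat k b`.
The statistic has null level sets (`law_expStat_eq_null`), so thresholding it at its `1 - α`
quantile gives size exactly `α`, and the Neyman–Pearson argument makes this test most powerful
against the mixture (`isMostPowerful_expTest`). By exchangeability its power against the mixture is
its power at a single spike. A minimax power is at most the average power over the spikes, which
yields the bound `minimaxPower_le_betaBar`.

Below the detection boundary, `|β̄ - α|` is at most `E_0 |L - 1|`, where `L` is the likelihood ratio
(`abs_betaBar_sub_le`). Here `L` is an average of `k` independent copies of a lognormal variable `Y`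
of mean one. Its variance need not vanish when `b ^ 2 ≥ log k`, so `Y` is truncated at `k` and a
moment of order `p = 1 + ε / 2` is used: the error is controlled by
`k ^ (1 - p) * E Y ^ p = k ^ (1 - p) * exp (p (p - 1) b ^ 2 / 2)`
(`integral_abs_average_sub_le`), a negative power of `k` when `b ^ 2 = (2 - ε) log k`.

Above the boundary, a union bound with the Gaussian tail `exp (-x ^ 2 / 2)` puts the least
favorable critical value below `√((2 + ε / 2) log k)` for large `k` (`supCrit_le`), while under the
alternative some coordinate has mean at most `θ₀ - √((2 + ε) log k)`. The gap between the two tends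
to infinity, so that coordinate alone causes rejection with probability tending to one.
-/

namespace MomentIneq

/-! ### Gaussian product laws and likelihood ratios -/

theorem pi_withDensity {ι : Type*} [Fintype ι] {Ω : ι → Type*} [∀ i, MeasurableSpace (Ω i)]
    (μ : ∀ i, Measure (Ω i)) [∀ i, IsProbabilityMeasure (μ i)]
    (f : ∀ i, Ω i → ENNReal) (hf : ∀ i, Measurable (f i))
    [∀ i, IsProbabilityMeasure ((μ i).withDensity (f i))] :
    Measure.pi (fun i => (μ i).withDensity (f i)) =
      (Measure.pi μ).withDensity (fun z => ∏ i, f i (z i)) := by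
  classical
  refine Measure.pi_eq fun s hs => ?_
  rw [withDensity_apply _ (MeasurableSet.univ_pi hs),
    ← lintegral_indicator (MeasurableSet.univ_pi hs)]
  have h : ∀ z : ∀ i, Ω i, (Set.univ.pi s).indicator (fun z => ∏ i, f i (z i)) z =
      ∏ i, (s i).indicator (f i) (z i) := by
    intro z
    by_cases hz : z ∈ Set.univ.pi s
    · rw [Set.indicator_of_mem hz]
      exact Finset.prod_congr rfl fun i _ => (Set.indicator_of_mem (hz i trivial) _).symm
    · rw [Set.indicator_of_notMem hz]
      simp only [Set.mem_pi, not_forall] at hz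
      obtain ⟨i, -, hi⟩ := hz
      exact (Finset.prod_eq_zero (Finset.mem_univ i) (Set.indicator_of_notMem hi _)).symm
  simp_rw [h]
  have hm : ∀ i, Measurable ((s i).indicator (f i)) := fun i => (hf i).indicator (hs i)
  rw [lintegral_prod_eq_prod_lintegral_of_indepFun Finset.univ
    (fun i (z : ∀ i, Ω i) => (s i).indicator (f i) (z i))
    (iIndepFun_pi fun i => (hm i).aemeasurable)
    (fun i => (hm i).comp (measurable_pi_apply i))]
  refine Finset.prod_congr rfl fun i _ => ?_
  rw [(measurePreserving_eval μ i).lintegral_comp (hm i), lintegral_indicator (hs i),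
    withDensity_apply _ (hs i)]

theorem gaussianReal_eq_withDensity (m : ℝ) :
    gaussianReal m 1 =
      (gaussianReal 0 1).withDensity (fun x => ENNReal.ofReal (Real.exp (m * x - m ^ 2 / 2))) := by
  rw [gaussianReal_of_var_ne_zero _ one_ne_zero, gaussianReal_of_var_ne_zero _ one_ne_zero,
    ← withDensity_mul _ (measurable_gaussianPDF 0 1) (by fun_prop)]
  congr 1
  ext x
  rw [Pi.mul_apply, gaussianPDF, gaussianPDF, ← ENNReal.ofReal_mul (gaussianPDFReal_nonneg _ _ _),
    gaussianPDFReal, gaussianPDFReal, mul_assoc _ (Real.exp _), ← Real.exp_add]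
  congr 3
  simp only [NNReal.coe_one]
  ring

instance isProbabilityMeasure_law {k : ℕ} (μ : Fin k → ℝ) : IsProbabilityMeasure (law μ) := by
  unfold law; infer_instance

theorem law_eq_withDensity {k : ℕ} (μ : Fin k → ℝ) :
    law μ = (law (0 : Fin k → ℝ)).withDensity
      (fun z => ENNReal.ofReal (∏ i, Real.exp (μ i * z i - μ i ^ 2 / 2))) := by
  have h := fun i => gaussianReal_eq_withDensity (μ i)
  have : ∀ i, IsProbabilityMeasure ((gaussianReal 0 1).withDensity
      (fun x => ENNReal.ofReal (Real.exp (μ i * x - μ i ^ 2 / 2)))) := fun i => by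
    rw [← h i]; infer_instance
  unfold law
  simp_rw [ENNReal.ofReal_prod_of_nonneg (fun _ _ => (Real.exp_pos _).le)]
  conv_lhs => enter [1, j]; rw [h j]
  exact pi_withDensity (fun _ : Fin k => gaussianReal 0 1) _ (fun i => by fun_prop)

theorem integral_law_single {k : ℕ} (j : Fin k) (b : ℝ) (φ : (Fin k → ℝ) → ℝ) :
    ∫ z, φ z ∂(law (Pi.single j (-b))) =
      ∫ z, Real.exp (-(z j) * b - b ^ 2 / 2) * φ z ∂(law (0 : Fin k → ℝ)) := by
  have h : ∀ z : Fin k → ℝ,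
      ∏ i, Real.exp ((Pi.single j (-b) : Fin k → ℝ) i * z i -
          (Pi.single j (-b) : Fin k → ℝ) i ^ 2 / 2)
        = Real.exp (-(z j) * b - b ^ 2 / 2) := by
    intro z
    rw [Finset.prod_eq_single j]
    · simp only [Pi.single_eq_same]; congr 1; ring
    · intro i _ hij; simp [Pi.single_eq_of_ne hij]
    · simp
  rw [law_eq_withDensity]
  simp_rw [h]
  rw [integral_withDensity_eq_integral_toReal_smul (by fun_prop) (by simp)]
  simp [ENNReal.toReal_ofReal (Real.exp_pos _).le]

theorem measurePreserving_add_const {k : ℕ} (μ : Fin k → ℝ) (t : ℝ) :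
    MeasurePreserving (fun (z : Fin k → ℝ) i => z i + t) (law μ) (law fun i => μ i + t) :=
  measurePreserving_pi (fun i => gaussianReal (μ i) 1) (fun i => gaussianReal (μ i + t) 1)
    (f := fun _ x => x + t) fun i => ⟨by fun_prop, gaussianReal_map_add_const t⟩

/-! ### Quantiles of atomless statistics -/

theorem continuous_cdf_of_nullSingleton (ν : Measure ℝ) [IsProbabilityMeasure ν]
    (h : ∀ x, ν {x} = 0) : Continuous (cdf ν) := by
  rw [continuous_iff_continuousAt]
  intro a
  rw [(monotone_cdf ν).continuousAt_iff_leftLim_eq_rightLim, (cdf ν).rightLim_eq]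
  have h1 := h a
  rw [← measure_cdf ν, StieltjesFunction.measure_singleton, ENNReal.ofReal_eq_zero] at h1
  exact le_antisymm ((monotone_cdf ν).leftLim_le le_rfl) (by linarith)

theorem measureReal_le_quantile {Ω : Type*} [MeasurableSpace Ω] (P : Measure Ω)
    [IsProbabilityMeasure P] {S : Ω → ℝ} (hS : Measurable S) (h : ∀ x, P {z | S z = x} = 0)
    {τ : ℝ} (h0 : 0 < τ) (h1 : τ < 1) : P.real {z | S z ≤ quantile P S τ} = τ := by
  have : IsProbabilityMeasure (P.map S) := Measure.isProbabilityMeasure_map hS.aemeasurable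
  set F := cdf (P.map S)
  have hF : ∀ x, P.real {z | S z ≤ x} = F x := fun x => by
    rw [cdf_eq_real, map_measureReal_apply hS measurableSet_Iic]; rfl
  have hc : Continuous F := continuous_cdf_of_nullSingleton _ fun x => by
    rw [Measure.map_apply hS (measurableSet_singleton x)]; exact h x
  have hbelow : ∃ x₀, ∀ x ≤ x₀, F x < τ :=
    eventually_atBot.1 ((tendsto_cdf_atBot (P.map S)).eventually_lt_const h0)
  obtain ⟨x₀, hx₀⟩ := hbelow
  obtain ⟨x₁, hx₁⟩ := ((tendsto_cdf_atTop (P.map S)).eventually_const_lt h1).exists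
  obtain ⟨y, hy⟩ : ∃ y, F y = τ := mem_range_of_exists_le_of_exists_ge hc
    ⟨x₀, (hx₀ x₀ le_rfl).le⟩ ⟨x₁, hx₁.le⟩
  have hb : BddBelow {x : ℝ | τ ≤ F x} :=
    ⟨x₀, fun x hx => le_of_not_gt fun hlt => (hx₀ x hlt.le).not_ge hx⟩
  unfold quantile
  simp_rw [hF]
  refine le_antisymm ?_ ?_
  · exact (monotone_cdf _ (csInf_le hb hy.ge)).trans_eq hy
  · exact (isClosed_le continuous_const hc).csInf_mem ⟨y, hy.ge⟩ hb

/-! ### The Neyman–Pearson test -/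

theorem measurable_expStat (k : ℕ) (b : ℝ) : Measurable (expStat k b) := by
  unfold expStat; fun_prop

/-- Given the remaining coordinates, at most one value of the first coordinate puts
`expStat` at a prescribed level, so the level sets are null by Fubini. -/
theorem law_expStat_eq_null {k : ℕ} (hk : 1 ≤ k) {b : ℝ} (hb : 0 < b) (μ : Fin k → ℝ) (c : ℝ) :
    law μ {z | expStat k b z = c} = 0 := by
  obtain ⟨n, rfl⟩ : ∃ n, k = n + 1 := ⟨k - 1, by omega⟩
  have := nullSingletonClass_gaussianReal (μ := μ 0) (one_ne_zero (α := NNReal))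
  have hmp := measurePreserving_piFinSuccAbove (fun i => gaussianReal (μ i) 1) 0
  let A : Set (ℝ × (Fin n → ℝ)) :=
    {p | Real.exp (-p.1 * b) + ∑ j, Real.exp (-(p.2 j) * b) = c}
  have hA : MeasurableSet A := measurableSet_eq_fun (by fun_prop) measurable_const
  have hpre : {z | expStat (n + 1) b z = c} =
      (MeasurableEquiv.piFinSuccAbove (fun _ => ℝ) 0) ⁻¹' A := by
    ext z
    simp [A, expStat, Fin.sum_univ_succ, MeasurableEquiv.piFinSuccAbove, Fin.tail]
  rw [hpre, law, hmp.measure_preimage hA.nullMeasurableSet, Measure.prod_apply_symm hA]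
  refine (lintegral_congr fun y => ?_).trans lintegral_zero
  refine Set.Subsingleton.measure_zero (fun x hx x' hx' => ?_) _
  have hx : Real.exp (-x * b) + ∑ j, Real.exp (-(y j) * b) = c := hx
  have hx' : Real.exp (-x' * b) + ∑ j, Real.exp (-(y j) * b) = c := hx'
  have : -x * b = -x' * b := Real.exp_injective (by linarith)
  nlinarith [mul_right_cancel₀ hb.ne' this]

theorem integral_thresholdTest {k : ℕ} (P : Measure (Fin k → ℝ)) {S : (Fin k → ℝ) → ℝ}
    (hS : Measurable S) (c : ℝ) : ∫ z, thresholdTest S c z ∂P = P.real {z | c < S z} :=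
  integral_indicator_one (measurableSet_lt measurable_const hS)

theorem isTest_thresholdTest {k : ℕ} {S : (Fin k → ℝ) → ℝ} (hS : Measurable S) (c : ℝ) :
    IsTest (thresholdTest S c) where
  measurable := measurable_one.indicator (measurableSet_lt measurable_const hS)
  mem_Icc z := by
    unfold thresholdTest
    by_cases h : z ∈ {z | c < S z} <;> simp [Set.indicator, h]

theorem IsTest.integrable {k : ℕ} {φ : (Fin k → ℝ) → ℝ} (h : IsTest φ) (P : Measure (Fin k → ℝ))
    [IsFiniteMeasure P] : Integrable φ P :=
  Integrable.of_mem_Icc 0 1 h.measurable.aemeasurable (Eventually.of_forall h.mem_Icc)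

theorem measureReal_expStat_le_expCrit {k : ℕ} (hk : 1 ≤ k) {α b : ℝ} (hα0 : 0 < α) (hα1 : α < 1)
    (hb : 0 < b) :
    (law (0 : Fin k → ℝ)).real {z | expStat k b z ≤ expCrit k α b} = 1 - α :=
  measureReal_le_quantile _ (measurable_expStat k b) (law_expStat_eq_null hk hb 0)
    (by linarith) (by linarith)

theorem expCrit_nonneg {k : ℕ} (hk : 1 ≤ k) {α b : ℝ} (hα0 : 0 < α) (hα1 : α < 1)
    (hb : 0 < b) : 0 ≤ expCrit k α b := by
  by_contra! hc
  have h := measureReal_expStat_le_expCrit hk hα0 hα1 hb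
  have he : {z | expStat k b z ≤ expCrit k α b} = ∅ := by
    ext z
    simp only [Set.mem_ofPred_eq, Set.mem_empty_iff_false, iff_false, not_le]
    exact hc.trans_le (Finset.sum_nonneg fun _ _ => (Real.exp_pos _).le)
  rw [he, measureReal_empty] at h
  linarith

theorem integral_expTest_zero {k : ℕ} (hk : 1 ≤ k) {α b : ℝ} (hα0 : 0 < α) (hα1 : α < 1)
    (hb : 0 < b) :
    ∫ z, thresholdTest (expStat k b) (expCrit k α b) z ∂(law (0 : Fin k → ℝ)) = α := by
  have h := measureReal_expStat_le_expCrit hk hα0 hα1 hb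
  have hm : MeasurableSet {z | expStat k b z ≤ expCrit k α b} :=
    measurableSet_le (measurable_expStat k b) measurable_const
  have hc : {z | expCrit k α b < expStat k b z} = {z | expStat k b z ≤ expCrit k α b}ᶜ := by
    ext z; simp
  rw [integral_thresholdTest _ (measurable_expStat k b), hc, probReal_compl_eq_one_sub hm, h]
  ring

/-- The likelihood ratio of `spikeMixture k b` with respect to `law 0`; for `k ≥ 1` it is
a positive multiple of `expStat k b`. -/
noncomputable def likelihoodRatio (k : ℕ) (b : ℝ) (z : Fin k → ℝ) : ℝ :=
  (k : ℝ)⁻¹ * ∑ j, Real.exp (-(z j) * b - b ^ 2 / 2)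

theorem likelihoodRatio_eq (k : ℕ) (b : ℝ) (z : Fin k → ℝ) :
    likelihoodRatio k b z = (k : ℝ)⁻¹ * Real.exp (-(b ^ 2 / 2)) * expStat k b z := by
  unfold likelihoodRatio expStat
  rw [mul_assoc]
  congr 1
  rw [Finset.mul_sum]
  refine Finset.sum_congr rfl fun j _ => ?_
  rw [← Real.exp_add]
  congr 1
  ring

theorem integrable_exp_eval {k : ℕ} (j : Fin k) (b : ℝ) :
    Integrable (fun z : Fin k → ℝ => Real.exp (-(z j) * b - b ^ 2 / 2))
      (law (0 : Fin k → ℝ)) := by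
  have h : Integrable (fun x : ℝ => Real.exp (-x * b - b ^ 2 / 2)) (gaussianReal 0 1) := by
    refine ((integrable_exp_mul_gaussianReal (μ := 0) (v := 1) (-b)).mul_const
      (Real.exp (-(b ^ 2 / 2)))).congr (Eventually.of_forall fun x => ?_)
    simp only [← Real.exp_add]
    congr 1; ring
  exact (measurePreserving_eval (fun _ : Fin k => gaussianReal 0 1)
    j).integrable_comp_of_integrable h

theorem integrable_likelihoodRatio (k : ℕ) (b : ℝ) :
    Integrable (likelihoodRatio k b) (law (0 : Fin k → ℝ)) :=
  (integrable_finsetSum _ fun j _ => integrable_exp_eval j b).const_mul _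

theorem IsTest.integrable_mul {k : ℕ} {φ : (Fin k → ℝ) → ℝ} (h : IsTest φ)
    {P : Measure (Fin k → ℝ)} {f : (Fin k → ℝ) → ℝ} (hf : Integrable f P) :
    Integrable (fun z => f z * φ z) P :=
  hf.mul_bdd (c := 1) h.measurable.aestronglyMeasurable (Eventually.of_forall fun z => by
    rw [Real.norm_eq_abs, abs_of_nonneg (h.mem_Icc z).1]; exact (h.mem_Icc z).2)

theorem integral_spikeMixture {k : ℕ} (b : ℝ) {φ : (Fin k → ℝ) → ℝ} (h : IsTest φ) :
    ∫ z, φ z ∂(spikeMixture k b) = (k : ℝ)⁻¹ * ∑ j, ∫ z, φ z ∂(law (Pi.single j (-b))) := by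
  rw [spikeMixture, integral_smul_measure, integral_finsetSum_measure
    (fun j _ => h.integrable _)]
  simp

theorem integral_spikeMixture_eq_likelihoodRatio {k : ℕ} (b : ℝ) {φ : (Fin k → ℝ) → ℝ}
    (h : IsTest φ) :
    ∫ z, φ z ∂(spikeMixture k b) =
      ∫ z, likelihoodRatio k b z * φ z ∂(law (0 : Fin k → ℝ)) := by
  rw [integral_spikeMixture b h]
  simp_rw [integral_law_single, likelihoodRatio, mul_assoc, Finset.sum_mul]
  rw [integral_const_mul, integral_finsetSum _ fun j _ => h.integrable_mul (integrable_exp_eval j b)]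

theorem isMostPowerful_expTest {k : ℕ} (hk : 1 ≤ k) {α b : ℝ} (hα0 : 0 < α) (hα1 : α < 1)
    (hb : 0 < b) :
    IsMostPowerful (law (0 : Fin k → ℝ)) (spikeMixture k b) α
      (thresholdTest (expStat k b) (expCrit k α b)) where
  toIsTest := isTest_thresholdTest (measurable_expStat k b) _
  size_eq := integral_expTest_zero hk hα0 hα1 hb
  le_power ψ hψ hψα := by
    have hφ := isTest_thresholdTest (measurable_expStat k b) (expCrit k α b)
    have hsize := integral_expTest_zero hk hα0 hα1 hb
    set φ := thresholdTest (expStat k b) (expCrit k α b)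
    rw [integral_spikeMixture_eq_likelihoodRatio b hψ, integral_spikeMixture_eq_likelihoodRatio b hφ]
    have hL := integrable_likelihoodRatio k b
    -- the threshold on the scale of the likelihood ratio
    set a := (k : ℝ)⁻¹ * Real.exp (-(b ^ 2 / 2))
    have ha0 : 0 ≤ a := by positivity
    have hc : 0 ≤ a * expCrit k α b := mul_nonneg ha0 (expCrit_nonneg hk hα0 hα1 hb)
    have hpt : ∀ z, 0 ≤ likelihoodRatio k b z * φ z - likelihoodRatio k b z * ψ z
        - a * expCrit k α b * (φ z - ψ z) := by
      intro z
      have hz := hψ.mem_Icc z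
      have hfac : likelihoodRatio k b z * φ z - likelihoodRatio k b z * ψ z
          - a * expCrit k α b * (φ z - ψ z)
          = a * ((expStat k b z - expCrit k α b) * (φ z - ψ z)) := by
        rw [likelihoodRatio_eq]; ring
      rw [hfac]
      refine mul_nonneg ha0 ?_
      by_cases h : expCrit k α b < expStat k b z
      · have : φ z = 1 := Set.indicator_of_mem (s := {z | expCrit k α b < expStat k b z}) h _
        rw [this]
        exact mul_nonneg (by linarith) (by linarith [hz.2])
      · have : φ z = 0 := Set.indicator_of_notMem (s := {z | expCrit k α b < expStat k b z}) h _
        rw [this]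
        exact mul_nonneg_of_nonpos_of_nonpos (by linarith) (by linarith [hz.1])
    have hint := integral_nonneg_of_ae (μ := law (0 : Fin k → ℝ)) (Eventually.of_forall hpt)
    have hi₁ : Integrable (fun z => likelihoodRatio k b z * φ z - likelihoodRatio k b z * ψ z)
        (law (0 : Fin k → ℝ)) := (hφ.integrable_mul hL).sub (hψ.integrable_mul hL)
    have hi₂ : Integrable (fun z => a * expCrit k α b * (φ z - ψ z)) (law (0 : Fin k → ℝ)) :=
      ((hφ.integrable _).sub (hψ.integrable _)).const_mul _
    rw [integral_sub hi₁ hi₂, integral_sub (hφ.integrable_mul hL) (hψ.integrable_mul hL),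
      integral_const_mul, integral_sub (hφ.integrable _) (hψ.integrable _), hsize] at hint
    nlinarith [mul_nonneg hc (sub_nonneg.2 hψα)]

theorem firstSpike_eq_single (n : ℕ) (b : ℝ) :
    firstSpike (n + 1) b = Pi.single 0 (-b) := by
  ext j
  rcases Fin.eq_zero_or_eq_succ j with rfl | ⟨i, rfl⟩ <;> simp [firstSpike]

/-- Permuting coordinates carries one spike alternative to any other and fixes `expStat`. -/
theorem law_single_expStat_eq_betaBar {k : ℕ} (α b : ℝ) (j : Fin k) :
    (law (Pi.single j (-b))).real {z | expCrit k α b < expStat k b z} = betaBar k α b := by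
  obtain ⟨n, rfl⟩ : ∃ n, k = n + 1 := ⟨k - 1, by have := j.2; omega⟩
  rw [betaBar, firstSpike_eq_single]
  have hmp := measurePreserving_piCongrLeft (α := fun _ : Fin (n + 1) => ℝ)
    (fun i => gaussianReal ((Pi.single 0 (-b) : Fin (n + 1) → ℝ) i) 1) (Equiv.swap 0 j)
  have hsingle : (fun i => gaussianReal
      ((Pi.single 0 (-b) : Fin (n + 1) → ℝ) (Equiv.swap 0 j i)) 1) =
      fun i => gaussianReal ((Pi.single j (-b) : Fin (n + 1) → ℝ) i) 1 := by
    ext1 i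
    congr 1
    simp only [Pi.single_apply, Equiv.swap_apply_eq_iff, Equiv.swap_apply_left]
  rw [hsingle] at hmp
  have hm : MeasurableSet {z | expCrit (n + 1) α b < expStat (n + 1) b z} :=
    measurableSet_lt measurable_const (measurable_expStat _ b)
  unfold law
  rw [measureReal_def, measureReal_def, ← hmp.measure_preimage hm.nullMeasurableSet]
  congr 2
  ext z
  have : expStat (n + 1) b
      (MeasurableEquiv.piCongrLeft (fun _ : Fin (n + 1) => ℝ) (Equiv.swap 0 j) z)
      = expStat (n + 1) b z := by
    unfold expStat
    rw [← Equiv.sum_comp (Equiv.swap 0 j)]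
    refine Finset.sum_congr rfl fun i _ => ?_
    rw [MeasurableEquiv.coe_piCongrLeft, Equiv.piCongrLeft_apply_apply]
  simp only [Set.mem_preimage, Set.mem_ofPred_eq, this]

theorem integral_spikeMixture_expTest {k : ℕ} (hk : 1 ≤ k) (α b : ℝ) :
    ∫ z, thresholdTest (expStat k b) (expCrit k α b) z ∂(spikeMixture k b) = betaBar k α b := by
  rw [integral_spikeMixture b (isTest_thresholdTest (measurable_expStat k b) _)]
  simp_rw [integral_thresholdTest _ (measurable_expStat k b), law_single_expStat_eq_betaBar]
  have : (k : ℝ) ≠ 0 := by positivity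
  simp [this]

theorem minimaxPower_le {k : ℕ} {θ₀ b : ℝ} {φ : (Fin k → ℝ) → ℝ} (h : IsTest φ)
    {μ : Fin k → ℝ} (hμ : μ ∈ altSet k θ₀ b) : minimaxPower θ₀ b φ ≤ ∫ z, φ z ∂(law μ) :=
  ciInf_le (f := fun μ : altSet k θ₀ b => ∫ z, φ z ∂(law μ.1))
    ⟨0, by rintro _ ⟨μ, rfl⟩; exact integral_nonneg fun z => (h.mem_Icc z).1⟩ ⟨μ, hμ⟩

theorem mem_altSet_of_le {k : ℕ} {θ₀ b : ℝ} {μ : Fin k → ℝ} (j : Fin k) (hj : μ j ≤ θ₀ - b) :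
    μ ∈ altSet k θ₀ b := fun _ hθ =>
  (Set.mem_Iic.1 hθ).trans ((ciInf_le (Set.finite_range μ).bddBelow j).trans hj)

/-- After translating the data by `θ₀`, a level `α` test has size at most `α` at `μ = 0`, and
its average power over the spikes `-b e_j` is at least its minimax power. -/
theorem minimaxPower_le_betaBar {k : ℕ} (hk : 1 ≤ k) {α b θ₀ : ℝ} (hα0 : 0 < α) (hα1 : α < 1)
    (hb : 0 < b) {φ : (Fin k → ℝ) → ℝ} (hφ : IsLevelTest α θ₀ φ) :
    minimaxPower θ₀ b φ ≤ betaBar k α b := by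
  have : Nonempty (Fin k) := ⟨⟨0, hk⟩⟩
  let ψ : (Fin k → ℝ) → ℝ := fun z => φ fun i => z i + θ₀
  have hψ : IsTest ψ := ⟨hφ.measurable.comp (by fun_prop), fun z => hφ.mem_Icc _⟩
  have hshift : ∀ μ : Fin k → ℝ, ∫ z, ψ z ∂(law μ) = ∫ z, φ z ∂(law fun i => μ i + θ₀) := by
    intro μ
    have hmp := measurePreserving_add_const μ θ₀
    rw [← hmp.map_eq, integral_map hmp.measurable.aemeasurable
      hφ.measurable.aestronglyMeasurable]
  have hsize : ∫ z, ψ z ∂(law (0 : Fin k → ℝ)) ≤ α := by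
    rw [hshift]
    refine hφ.size_le _ ?_
    simp [nullSet, identifiedSet]
  rw [← integral_spikeMixture_expTest hk]
  refine le_trans ?_ ((isMostPowerful_expTest hk hα0 hα1 hb).le_power ψ hψ hsize)
  rw [integral_spikeMixture b hψ]
  have hle : ∀ j : Fin k, minimaxPower θ₀ b φ ≤ ∫ z, ψ z ∂(law (Pi.single j (-b))) := by
    intro j
    rw [hshift]
    refine minimaxPower_le hφ.toIsTest (mem_altSet_of_le j ?_)
    simp only [Pi.single_eq_same]
    linarith
  have hk0 : (k : ℝ) ≠ 0 := by positivity
  calc minimaxPower θ₀ b φ = (k : ℝ)⁻¹ * ∑ _j : Fin k, minimaxPower θ₀ b φ := by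
        simp [hk0]
    _ ≤ _ := by gcongr with j; exact hle j

/-! ### An `L¹` law of large numbers by truncation -/

theorem integral_abs_sub_integral_le_sqrt_variance {Ω : Type*} [MeasurableSpace Ω] {P : Measure Ω}
    [IsProbabilityMeasure P] {X : Ω → ℝ} (hX : MemLp X 2 P) :
    ∫ ω, |X ω - ∫ ω', X ω' ∂P| ∂P ≤ √(Var[X; P]) := by
  have hY : MemLp (fun ω => |X ω - ∫ ω', X ω' ∂P|) 2 P := (hX.sub (memLp_const _)).abs
  refine Real.le_sqrt_of_sq_le ?_
  have h := variance_nonneg (fun ω => |X ω - ∫ ω', X ω' ∂P|) P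
  rw [variance_eq_sub hY] at h
  rw [variance_eq_integral hX.aestronglyMeasurable.aemeasurable]
  have he : ∫ ω, ((fun ω => |X ω - ∫ ω', X ω' ∂P|) ^ 2) ω ∂P
      = ∫ ω, (X ω - ∫ ω', X ω' ∂P) ^ 2 ∂P := by
    simp [sq_abs]
  linarith

/-- A quantitative weak law of large numbers in `L¹` under a `p`-th moment, `1 ≤ p ≤ 2`. The
summands are split at height `k`: both the second moment of the truncated part, divided by `k`,
and the mean of the discarded part are at most `k ^ (1 - p) * ∫ g ^ p`. -/
theorem integral_abs_average_sub_le {γ : Measure ℝ} [IsProbabilityMeasure γ] {g : ℝ → ℝ}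
    (hg : Measurable g) (hg0 : ∀ x, 0 < g x) (hgi : Integrable g γ) {p : ℝ} (hp1 : 1 ≤ p)
    (hp2 : p ≤ 2) (hgp : Integrable (fun x => g x ^ p) γ) {k : ℕ} (hk : 1 ≤ k) :
    ∫ z : Fin k → ℝ, |(k : ℝ)⁻¹ * ∑ j, g (z j) - ∫ x, g x ∂γ| ∂(Measure.pi fun _ => γ) ≤
      √((k : ℝ) ^ (1 - p) * ∫ x, g x ^ p ∂γ) + 2 * ((k : ℝ) ^ (1 - p) * ∫ x, g x ^ p ∂γ) := by
  set P : Measure (Fin k → ℝ) := Measure.pi fun _ => γ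
  have hk0 : (0 : ℝ) < k := by exact_mod_cast hk
  set R := (k : ℝ) ^ (1 - p) * ∫ x, g x ^ p ∂γ with hR
  -- `h` is the truncated summand, `r` the discarded part
  set h : ℝ → ℝ := fun x => if g x ≤ k then g x else 0 with hh
  set r : ℝ → ℝ := fun x => g x - h x with hr
  have hhm : Measurable h := Measurable.ite (measurableSet_le hg measurable_const) hg
    measurable_const
  have hh0 : ∀ x, 0 ≤ h x := fun x => by
    simp only [hh]; split_ifs; exacts [(hg0 x).le, le_rfl]
  have hhk : ∀ x, h x ≤ k := fun x => by
    simp only [hh]; split_ifs with hx; exacts [hx, hk0.le]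
  have hr0 : ∀ x, 0 ≤ r x := fun x => by
    simp only [hr, hh]; split_ifs <;> linarith [hg0 x]
  have hhL : MemLp h 2 γ := MemLp.of_bound hhm.aestronglyMeasurable (k : ℝ)
    (Eventually.of_forall fun x => by rw [Real.norm_of_nonneg (hh0 x)]; exact hhk x)
  have hhi : Integrable h γ := hhL.integrable one_le_two
  have hri : Integrable r γ := hgi.sub hhi
  have hrR : ∫ x, r x ∂γ ≤ R := by
    rw [hR, ← integral_const_mul]
    refine integral_mono hri (hgp.const_mul _) fun x => ?_
    simp only [hr, hh]
    split_ifs with hx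
    · rw [sub_self]
      exact mul_nonneg (Real.rpow_nonneg hk0.le _) (Real.rpow_nonneg (hg0 x).le _)
    · push Not at hx
      rw [sub_zero]
      calc g x = g x ^ (1 - p) * g x ^ p := by
            rw [← Real.rpow_add (hg0 x)]; simp
        _ ≤ (k : ℝ) ^ (1 - p) * g x ^ p :=
            mul_le_mul_of_nonneg_right (Real.rpow_le_rpow_of_nonpos hk0 hx.le (by linarith))
              (Real.rpow_nonneg (hg0 x).le _)
  have hhR : (k : ℝ)⁻¹ * ∫ x, h x ^ 2 ∂γ ≤ R := by
    rw [hR, ← integral_const_mul, ← integral_const_mul]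
    refine integral_mono (hhL.integrable_sq.const_mul _) (hgp.const_mul _) fun x => ?_
    simp only [hh]
    split_ifs with hx
    · calc (k : ℝ)⁻¹ * g x ^ 2 = (k : ℝ)⁻¹ * (g x ^ (2 - p) * g x ^ p) := by
            rw [← Real.rpow_add (hg0 x)]; norm_num
        _ ≤ (k : ℝ)⁻¹ * ((k : ℝ) ^ (2 - p) * g x ^ p) := by
            gcongr
            · exact Real.rpow_nonneg (hg0 x).le _
            · exact (hg0 x).le
        _ = (k : ℝ) ^ (1 - p) * g x ^ p := by
            rw [← mul_assoc, ← Real.rpow_neg_one, ← Real.rpow_add hk0]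
            congr 2; ring
    · rw [zero_pow two_ne_zero, mul_zero]
      exact mul_nonneg (Real.rpow_nonneg hk0.le _) (Real.rpow_nonneg (hg0 x).le _)
  have hmp : ∀ j : Fin k, MeasurePreserving (fun z : Fin k → ℝ => z j) P γ :=
    fun j => measurePreserving_eval (fun _ => γ) j
  have hsum : ∀ f : ℝ → ℝ, Integrable f γ →
      Integrable (fun z : Fin k → ℝ => (k : ℝ)⁻¹ * ∑ j, f (z j)) P ∧
      ∫ z, (k : ℝ)⁻¹ * ∑ j, f (z j) ∂P = ∫ x, f x ∂γ := by
    intro f hf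
    have hi : ∀ j : Fin k, Integrable (fun z : Fin k → ℝ => f (z j)) P :=
      fun j => (hmp j).integrable_comp_of_integrable hf
    refine ⟨(integrable_finsetSum _ fun j _ => hi j).const_mul _, ?_⟩
    rw [integral_const_mul, integral_finsetSum _ fun j _ => hi j]
    have : ∀ j : Fin k, ∫ z, f (z j) ∂P = ∫ x, f x ∂γ := fun j =>
      integral_comp_eval (μ := fun _ : Fin k => γ) (i := j) hf.aestronglyMeasurable
    simp [this, hk0.ne']
  set X : (Fin k → ℝ) → ℝ := fun z => (k : ℝ)⁻¹ * ∑ j, h (z j) with hX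
  have hXL : MemLp X 2 P :=
    (memLp_finsetSum _ fun j _ => hhL.comp_measurePreserving (hmp j)).const_mul _
  have hvar : Var[X; P] ≤ R := by
    have h1 : Var[∑ j : Fin k, fun z : Fin k → ℝ => h (z j); P] = ∑ _j : Fin k, Var[h; γ] :=
      variance_sum_pi fun _ => hhL
    have h2 : X = fun z => (k : ℝ)⁻¹ * (∑ j : Fin k, fun z : Fin k → ℝ => h (z j)) z := by
      ext z; simp [hX]
    rw [h2, variance_const_mul, h1, Finset.sum_const, Finset.card_univ, Fintype.card_fin,
      nsmul_eq_mul]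
    have h3 : Var[h; γ] ≤ ∫ x, h x ^ 2 ∂γ := variance_le_expectation_sq hhm.aestronglyMeasurable
    calc (k : ℝ)⁻¹ ^ 2 * (k * Var[h; γ]) = (k : ℝ)⁻¹ * Var[h; γ] := by field_simp
      _ ≤ (k : ℝ)⁻¹ * ∫ x, h x ^ 2 ∂γ := by gcongr
      _ ≤ R := hhR
  obtain ⟨hXi, hXm⟩ := hsum h hhi
  obtain ⟨hWi, hWm⟩ := hsum r hri
  have hgm : ∫ x, g x ∂γ = ∫ x, h x ∂γ + ∫ x, r x ∂γ := by
    rw [← integral_add hhi hri]; simp [hr]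
  have hr1 : 0 ≤ ∫ x, r x ∂γ := integral_nonneg hr0
  have hpt : ∀ z : Fin k → ℝ, |(k : ℝ)⁻¹ * ∑ j, g (z j) - ∫ x, g x ∂γ| ≤
      |X z - ∫ z', X z' ∂P| + ((k : ℝ)⁻¹ * ∑ j, r (z j) + ∫ x, r x ∂γ) := by
    intro z
    have hs : (k : ℝ)⁻¹ * ∑ j, g (z j) = X z + (k : ℝ)⁻¹ * ∑ j, r (z j) := by
      rw [hX, ← mul_add, ← Finset.sum_add_distrib]
      simp [hr]
    have hw : 0 ≤ (k : ℝ)⁻¹ * ∑ j, r (z j) :=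
      mul_nonneg (by positivity) (Finset.sum_nonneg fun j _ => hr0 _)
    rw [hs, hgm, ← hXm]
    rw [abs_le]
    constructor <;> linarith [neg_abs_le (X z - ∫ z', X z' ∂P), le_abs_self (X z - ∫ z', X z' ∂P)]
  have hBi : Integrable (fun z : Fin k → ℝ => (k : ℝ)⁻¹ * ∑ j, r (z j) + ∫ x, r x ∂γ) P :=
    hWi.add (integrable_const _)
  have hAi : Integrable (fun z => |X z - ∫ z', X z' ∂P|) P := (hXi.sub (integrable_const _)).abs
  calc ∫ z : Fin k → ℝ, |(k : ℝ)⁻¹ * ∑ j, g (z j) - ∫ x, g x ∂γ| ∂P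
      ≤ ∫ z, (|X z - ∫ z', X z' ∂P| + ((k : ℝ)⁻¹ * ∑ j, r (z j) + ∫ x, r x ∂γ)) ∂P :=
        integral_mono ((hsum g hgi).1.sub (integrable_const _)).abs
          (hAi.add hBi) hpt
    _ = ∫ z, |X z - ∫ z', X z' ∂P| ∂P + 2 * ∫ x, r x ∂γ := by
        rw [integral_add hAi hBi, integral_add hWi (integrable_const _),
          hWm, integral_const, probReal_univ, one_smul]
        ring
    _ ≤ √R + 2 * R := by
        gcongr
        exact (integral_abs_sub_integral_le_sqrt_variance hXL).trans (Real.sqrt_le_sqrt hvar)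

/-! ### The power bound below the detection boundary -/

theorem integral_exp_gaussianReal (s c : ℝ) :
    ∫ x, Real.exp (s * x + c) ∂(gaussianReal 0 1) = Real.exp (s ^ 2 / 2 + c) := by
  have h := congrFun (mgf_id_gaussianReal (μ := 0) (v := 1)) s
  simp only [mgf, id] at h
  simp_rw [Real.exp_add]
  rw [integral_mul_const, h]
  simp

theorem integrable_exp_gaussianReal (s c : ℝ) :
    Integrable (fun x => Real.exp (s * x + c)) (gaussianReal 0 1) := by
  simp_rw [Real.exp_add]
  exact (integrable_exp_mul_gaussianReal s).mul_const _

theorem integral_abs_likelihoodRatio_sub_one_le {k : ℕ} (hk : 1 ≤ k) (b : ℝ) {p : ℝ} (hp1 : 1 ≤ p)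
    (hp2 : p ≤ 2) :
    ∫ z, |likelihoodRatio k b z - 1| ∂(law (0 : Fin k → ℝ)) ≤
      √((k : ℝ) ^ (1 - p) * Real.exp (p * (p - 1) * b ^ 2 / 2)) +
        2 * ((k : ℝ) ^ (1 - p) * Real.exp (p * (p - 1) * b ^ 2 / 2)) := by
  have hgp : ∀ x : ℝ, Real.exp (-b * x + -(b ^ 2 / 2)) ^ p =
      Real.exp (-b * p * x + -(b ^ 2 / 2) * p) := fun x => by
    rw [← Real.exp_mul]; congr 1; ring
  have h := integral_abs_average_sub_le (γ := gaussianReal 0 1)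
    (g := fun x => Real.exp (-b * x + -(b ^ 2 / 2))) (by fun_prop) (fun _ => Real.exp_pos _)
    (integrable_exp_gaussianReal _ _) hp1 hp2
    (by simp_rw [hgp]; exact integrable_exp_gaussianReal _ _) hk
  simp_rw [hgp, integral_exp_gaussianReal] at h
  have e1 : Real.exp ((-b) ^ 2 / 2 + -(b ^ 2 / 2)) = 1 := by
    rw [Real.exp_eq_one_iff]; ring
  have e2 : (-b * p) ^ 2 / 2 + -(b ^ 2 / 2) * p = p * (p - 1) * b ^ 2 / 2 := by ring
  rw [e1, e2] at h
  refine le_trans (le_of_eq ?_) h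
  have hlaw : law (0 : Fin k → ℝ) = Measure.pi fun _ => gaussianReal 0 1 := rfl
  rw [hlaw]
  refine integral_congr_ae (Eventually.of_forall fun z => ?_)
  simp only [likelihoodRatio]
  congr 4 with j
  congr 1
  ring

theorem abs_betaBar_sub_le {k : ℕ} (hk : 1 ≤ k) {α b : ℝ} (hα0 : 0 < α) (hα1 : α < 1)
    (hb : 0 < b) :
    |betaBar k α b - α| ≤ ∫ z, |likelihoodRatio k b z - 1| ∂(law (0 : Fin k → ℝ)) := by
  have hφ := isTest_thresholdTest (measurable_expStat k b) (expCrit k α b)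
  have hL := integrable_likelihoodRatio k b
  have hsize := integral_expTest_zero hk hα0 hα1 hb
  have hpow := integral_spikeMixture_expTest hk α b
  rw [integral_spikeMixture_eq_likelihoodRatio b hφ] at hpow
  rw [← hpow]
  nth_rw 2 [← hsize]
  rw [← integral_sub (hφ.integrable_mul hL) (hφ.integrable _)]
  refine abs_integral_le_integral_abs.trans ?_
  refine integral_mono ((hφ.integrable_mul hL).sub (hφ.integrable _)).abs
    (hL.sub (integrable_const _)).abs fun z => ?_
  have hz := hφ.mem_Icc z
  set t := thresholdTest (expStat k b) (expCrit k α b) z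
  calc |likelihoodRatio k b z * t - t| = |likelihoodRatio k b z - 1| * t := by
        rw [← sub_one_mul, abs_mul, abs_of_nonneg hz.1]
    _ ≤ |likelihoodRatio k b z - 1| := mul_le_of_le_one_right (abs_nonneg _) hz.2

theorem tendsto_log_natCast_atTop : Tendsto (fun k : ℕ => Real.log k) atTop atTop :=
  Real.tendsto_log_atTop.comp tendsto_natCast_atTop_atTop

/-- With moment order `p = 1 + ε / 2`, the error `k ^ (1 - p) * E g ^ p` at
`b ^ 2 = (2 - ε) log k` equals `k ^ (- ε ^ 3 / 8)`. -/
theorem tendsto_betaBar {α : ℝ} (hα0 : 0 < α) (hα1 : α < 1) {ε : ℝ} (hε0 : 0 < ε) (hε2 : ε < 2) :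
    Tendsto (fun k : ℕ => betaBar k α (√((2 - ε) * Real.log k))) atTop (𝓝 α) := by
  set R : ℕ → ℝ := fun k => Real.exp (-(ε ^ 3 / 8) * Real.log k)
  have hR : Tendsto R atTop (𝓝 0) := Real.tendsto_exp_atBot.comp
    (tendsto_log_natCast_atTop.const_mul_atTop_of_neg (neg_lt_zero.2 (by positivity)))
  have hbound : Tendsto (fun k => √(R k) + 2 * R k) atTop (𝓝 0) := by
    simpa using hR.sqrt.add (hR.const_mul 2)
  rw [tendsto_iff_norm_sub_tendsto_zero]
  refine squeeze_zero' (Eventually.of_forall fun _ => norm_nonneg _) ?_ hbound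
  filter_upwards [eventually_ge_atTop 2] with k hk
  have hk0 : (0 : ℝ) < k := by positivity
  have hlog : 0 < Real.log k := Real.log_pos (by exact_mod_cast hk)
  have hb2 : 0 < (2 - ε) * Real.log k := mul_pos (by linarith) hlog
  have h := (abs_betaBar_sub_le (by omega : 1 ≤ k) hα0 hα1 (Real.sqrt_pos.2 hb2)).trans
    (integral_abs_likelihoodRatio_sub_one_le (by omega) _ (p := 1 + ε / 2) (by linarith)
      (by linarith))
  rw [Real.sq_sqrt hb2.le, Real.rpow_def_of_pos hk0, ← Real.exp_add] at h
  have he : Real.log k * (1 - (1 + ε / 2)) +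
      (1 + ε / 2) * (1 + ε / 2 - 1) * ((2 - ε) * Real.log k) / 2 =
      -(ε ^ 3 / 8) * Real.log k := by ring
  rw [he] at h
  exact h

/-! ### Power of the supremum test above the detection boundary -/

theorem measureReal_ge_le_of_map_eq_gaussianReal {Ω : Type*} [MeasurableSpace Ω] {P : Measure Ω}
    [IsProbabilityMeasure P] {X : Ω → ℝ} (hX : MeasurePreserving X P (gaussianReal 0 1)) {x : ℝ}
    (hx : 0 ≤ x) : P.real {ω | x ≤ X ω} ≤ Real.exp (-(x ^ 2 / 2)) := by
  refine (measure_ge_le_exp_mul_mgf x hx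
    (hX.integrable_comp_of_integrable (integrable_exp_mul_gaussianReal x))).trans_eq ?_
  rw [mgf_gaussianReal hX.map_eq, ← Real.exp_add]
  congr 1
  simp only [NNReal.coe_one]
  ring

theorem measurePreserving_sub_mean {k : ℕ} (μ : Fin k → ℝ) (j : Fin k) :
    MeasurePreserving (fun z : Fin k → ℝ => z j - μ j) (law μ) (gaussianReal 0 1) :=
  (⟨by fun_prop, by simpa using gaussianReal_map_sub_const (μ := μ j) (v := 1) (μ j)⟩ :
    MeasurePreserving (fun x => x - μ j) (gaussianReal (μ j) 1) (gaussianReal 0 1)).comp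
    (measurePreserving_eval (fun i => gaussianReal (μ i) 1) j)

theorem measurePreserving_mean_sub {k : ℕ} (μ : Fin k → ℝ) (j : Fin k) :
    MeasurePreserving (fun z : Fin k → ℝ => μ j - z j) (law μ) (gaussianReal 0 1) :=
  (⟨by fun_prop, by simpa using gaussianReal_map_const_sub (μ := μ j) (v := 1) (μ j)⟩ :
    MeasurePreserving (fun x => μ j - x) (gaussianReal (μ j) 1) (gaussianReal 0 1)).comp
    (measurePreserving_eval (fun i => gaussianReal (μ i) 1) j)

theorem measurable_supStat (k : ℕ) (θ : ℝ) : Measurable (supStat k θ) :=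
  Measurable.iSup fun j => by fun_prop

theorem le_supStat {k : ℕ} (θ : ℝ) (z : Fin k → ℝ) (j : Fin k) :
    max (θ - z j) 0 ≤ supStat k θ z :=
  le_ciSup (f := fun j => max (θ - z j) 0) (Set.finite_range _).bddAbove j

/-- The union bound over the `k` coordinates, with the tail bound `exp (-x ^ 2 / 2)`, controls
the critical value. -/
theorem supCrit_le {k : ℕ} (hk : 1 ≤ k) {α x : ℝ} (hα1 : α < 1) (hx : 0 ≤ x)
    (hxα : k * Real.exp (-(x ^ 2 / 2)) ≤ α) : supCrit k α ≤ x := by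
  have : Nonempty (Fin k) := ⟨⟨0, hk⟩⟩
  refine csSup_le ⟨_, 0, 0, by simp [identifiedSet], rfl⟩ ?_
  rintro _ ⟨μ, θ, hθ, rfl⟩
  have hθ : ∀ j, θ ≤ μ j := fun j =>
    (Set.mem_Iic.1 hθ).trans (ciInf_le (Set.finite_range μ).bddBelow j)
  refine csInf_le ⟨0, fun y hy => ?_⟩ ?_
  · -- the statistic is nonnegative, so its distribution function vanishes on the negative axis
    by_contra! hy0
    have he : {z | supStat k θ z ≤ y} = ∅ := by
      ext z
      simp only [Set.mem_ofPred_eq, Set.mem_empty_iff_false, iff_false, not_le]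
      exact hy0.trans_le ((le_max_right _ _).trans (le_supStat θ z ⟨0, hk⟩))
    have hy : 1 - α ≤ (law μ).real {z | supStat k θ z ≤ y} := hy
    rw [he, measureReal_empty] at hy
    linarith
  · have hm : MeasurableSet {z | supStat k θ z ≤ x} :=
      measurableSet_le (measurable_supStat k θ) measurable_const
    have hsub : {z | supStat k θ z ≤ x}ᶜ ⊆ ⋃ j, {z : Fin k → ℝ | x ≤ μ j - z j} := by
      intro z hz
      by_contra hcon
      simp only [Set.mem_iUnion, Set.mem_ofPred_eq, not_exists, not_le] at hcon
      exact hz (ciSup_le fun j => max_le (by linarith [hθ j, hcon j]) hx)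
    have hle : (law μ).real {z | supStat k θ z ≤ x}ᶜ ≤ α := calc
      _ ≤ (law μ).real (⋃ j, {z : Fin k → ℝ | x ≤ μ j - z j}) := measureReal_mono hsub
      _ ≤ ∑ j, (law μ).real {z : Fin k → ℝ | x ≤ μ j - z j} := measureReal_iUnion_fintype_le _
      _ ≤ ∑ _j : Fin k, Real.exp (-(x ^ 2 / 2)) := Finset.sum_le_sum fun j _ =>
          measureReal_ge_le_of_map_eq_gaussianReal (measurePreserving_mean_sub μ j) hx
      _ ≤ α := by simpa using hxα
    rw [probReal_compl_eq_one_sub hm] at hle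
    simp only [Set.mem_ofPred_eq]
    linarith

theorem le_minimaxPower_supTest {k : ℕ} (hk : 1 ≤ k) {α θ₀ b x : ℝ} (hx : supCrit k α ≤ x)
    (hxb : x ≤ b) :
    1 - Real.exp (-((b - x) ^ 2 / 2)) ≤ minimaxPower θ₀ b (supTest k α θ₀) := by
  have : Nonempty (Fin k) := ⟨⟨0, hk⟩⟩
  have : Nonempty (altSet k θ₀ b) :=
    ⟨⟨fun _ => θ₀ - b, mem_altSet_of_le ⟨0, hk⟩ le_rfl⟩⟩
  refine le_ciInf fun ⟨μ, hμ⟩ => ?_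
  obtain ⟨j, hj⟩ := exists_eq_ciInf_of_finite (f := μ)
  have hμj : μ j ≤ θ₀ - b := hμ _ (Set.mem_Iic.2 hj.le)
  rw [supTest, integral_thresholdTest _ (measurable_supStat k θ₀)]
  have hm : MeasurableSet {z | supCrit k α < supStat k θ₀ z} :=
    measurableSet_lt measurable_const (measurable_supStat k θ₀)
  have hsub : {z | supCrit k α < supStat k θ₀ z}ᶜ ⊆ {z | b - x ≤ z j - μ j} := by
    intro z hz
    have hz : supStat k θ₀ z ≤ supCrit k α := not_lt.1 hz
    have := (le_max_left _ _).trans (le_supStat θ₀ z j)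
    simp only [Set.mem_ofPred_eq]
    linarith
  have hle := (measureReal_mono (μ := law μ) hsub).trans
    (measureReal_ge_le_of_map_eq_gaussianReal (measurePreserving_sub_mean μ j)
      (sub_nonneg.2 hxb))
  rw [probReal_compl_eq_one_sub hm] at hle
  linarith

theorem minimaxPower_le_one {k : ℕ} (hk : 1 ≤ k) {θ₀ b : ℝ} {φ : (Fin k → ℝ) → ℝ}
    (h : IsTest φ) : minimaxPower θ₀ b φ ≤ 1 := by
  refine (minimaxPower_le h (mem_altSet_of_le (μ := fun _ => θ₀ - b) ⟨0, hk⟩ le_rfl)).trans ?_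
  refine (integral_mono (h.integrable _) (integrable_const 1) fun z => (h.mem_Icc z).2).trans ?_
  simp

theorem tendsto_minimaxPower_supTest {α : ℝ} (hα0 : 0 < α) (hα1 : α < 1) (θ₀ : ℝ) {ε : ℝ}
    (hε : 0 < ε) :
    Tendsto (fun k : ℕ => minimaxPower θ₀ (√((2 + ε) * Real.log k)) (supTest k α θ₀))
      atTop (𝓝 1) := by
  -- an intermediate level between the critical value and the separation `b`
  set x : ℕ → ℝ := fun k => √((2 + ε / 2) * Real.log k) with hx
  set b : ℕ → ℝ := fun k => √((2 + ε) * Real.log k) with hb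
  have hgap : 0 < √(2 + ε) - √(2 + ε / 2) :=
    sub_pos.2 (Real.sqrt_lt_sqrt (by linarith) (by linarith))
  have hbx : ∀ k, b k - x k = (√(2 + ε) - √(2 + ε / 2)) * √(Real.log k) := fun k => by
    simp only [hb, hx]
    rw [Real.sqrt_mul (by linarith), Real.sqrt_mul (by linarith), sub_mul]
  have hdiff : Tendsto (fun k => b k - x k) atTop atTop := by
    simp_rw [hbx]
    exact (Real.tendsto_sqrt_atTop.comp tendsto_log_natCast_atTop).const_mul_atTop hgap
  have hlow : Tendsto (fun k => 1 - Real.exp (-((b k - x k) ^ 2 / 2))) atTop (𝓝 1) := by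
    have := Real.tendsto_exp_neg_atTop_nhds_zero.comp
      (((tendsto_pow_atTop two_ne_zero).comp hdiff).atTop_div_const two_pos)
    simpa using this.const_sub 1
  refine tendsto_of_tendsto_of_tendsto_of_le_of_le' hlow tendsto_const_nhds ?_ ?_
  · filter_upwards [eventually_ge_atTop 1,
      tendsto_log_natCast_atTop.eventually_ge_atTop (-Real.log α * (4 / ε))] with k hk hlog
    have hk0 : (0 : ℝ) < k := by positivity
    have hlog0 : 0 ≤ Real.log k := Real.log_natCast_nonneg k
    refine le_minimaxPower_supTest hk (supCrit_le hk hα1 (Real.sqrt_nonneg _) ?_) ?_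
    · simp only [hx]
      rw [Real.sq_sqrt (by positivity)]
      calc (k : ℝ) * Real.exp (-((2 + ε / 2) * Real.log k / 2))
          = Real.exp (Real.log k + -((2 + ε / 2) * Real.log k / 2)) := by
            rw [Real.exp_add, Real.exp_log hk0]
        _ ≤ Real.exp (Real.log α) := by
            refine Real.exp_le_exp.2 ?_
            have := mul_le_mul_of_nonneg_left hlog (by positivity : 0 ≤ ε / 4)
            have he : ε / 4 * (-Real.log α * (4 / ε)) = -Real.log α := by field_simp
            linarith
        _ = α := Real.exp_log hα0
    · exact Real.sqrt_le_sqrt (mul_le_mul_of_nonneg_right (by linarith) hlog0)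
  · filter_upwards [eventually_ge_atTop 1] with k hk
    exact minimaxPower_le_one hk (isTest_thresholdTest (measurable_supStat k θ₀) _)

end MomentIneq

theorem theorem4 (α : ℝ) (hα0 : 0 < α) (hα1 : α < 1) (θ₀ : ℝ) :
    (∀ (k : ℕ), 1 ≤ k → ∀ b : ℝ, 0 < b →
      (∀ φ : (Fin k → ℝ) → ℝ, MomentIneq.IsLevelTest α θ₀ φ →
        MomentIneq.minimaxPower θ₀ b φ ≤ MomentIneq.betaBar k α b) ∧
      MomentIneq.IsMostPowerful (MomentIneq.law (0 : Fin k → ℝ)) (MomentIneq.spikeMixture k b) α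
        (MomentIneq.thresholdTest (MomentIneq.expStat k b) (MomentIneq.expCrit k α b)) ∧
      ∫ z, MomentIneq.thresholdTest (MomentIneq.expStat k b) (MomentIneq.expCrit k α b) z
        ∂(MomentIneq.spikeMixture k b) = MomentIneq.betaBar k α b) ∧
    (∀ ε : ℝ, 0 < ε → ε < 2 →
      Tendsto (fun k : ℕ => MomentIneq.betaBar k α (Real.sqrt ((2 - ε) * Real.log k)))
        atTop (𝓝 α)) ∧
    (∀ ε : ℝ, 0 < ε →
      Tendsto (fun k : ℕ => MomentIneq.minimaxPower θ₀ (Real.sqrt ((2 + ε) * Real.log k))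
        (MomentIneq.supTest k α θ₀)) atTop (𝓝 1)) := by
  refine ⟨fun k hk b hb => ⟨fun φ hφ => ?_, ?_, ?_⟩, fun ε hε0 hε2 => ?_, fun ε hε => ?_⟩
  · exact MomentIneq.minimaxPower_le_betaBar hk hα0 hα1 hb hφ
  · exact MomentIneq.isMostPowerful_expTest hk hα0 hα1 hb
  · exact MomentIneq.integral_spikeMixture_expTest hk α b
  · exact MomentIneq.tendsto_betaBar hα0 hα1 hε0 hε2
  · exact MomentIneq.tendsto_minimaxPower_supTest hα0 hα1 θ₀ hε
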